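/- Let $(\mathcal X\times[K],\mathbb P)$ be a probability space with balanced class priors, $\mathbb P(y=k)=1/K$ for every $k\in[K]$, let $\phi:\mathcal X\to\mathbb R^d$ be a fixed measurable feature encoder, $\Lambda\in\mathbb R$, $\mathcal F=\{(x,y)\mapsto w_y^\top\phi(x)\mid w_y\in\mathbb R^d,\ \|w_y\|_2\le\Lambda \text{ for all } y\in[K]\}$, and let $\boldsymbol\gamma=(\gamma_1,\dots,\gamma_K)$ be fixed margins with all $\gamma_k>0$. For $f\in\mathcal F$ let $\mathcal R(f)=\mathbb P\big(y\ne\arg\max_{k}f(x,k)\big)$ be the 0-1 risk (ties broken by any fixed rule). For a sample $\mathcal D=((x_i,y_i))_{i=1}^N$, $N\ge1$, let $$\widehat{\mathcal R}^{\boldsymbol\gamma,\mathsf{ce}}_{\mathcal D}(f)=\frac1N\sum_{i=1}^N\Big(-\ln\frac{e^{f(x_i,y_i)/\gamma_{y_i}}}{\sum_{k=1}^K e^{f(x_i,k)/\gamma_{y_i}}}\Big)$$ be the empirical $\boldsymbol\gamma$-margin cross-entropy risk. With $I_k=\{i: y_i=k\}$, let $$\hat\mu_k=\frac1{|I_k|}\sum_{i\in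 I_k}\phi(x_i),\qquad \|\hat s_k\|_2^2=\frac1{|I_k|}\sum_{i\in I_k}\|\phi(x_i)-\hat\mu_k\|_2^2$$ (both taken to be $0$ when $I_k=\emptyset$) be the empirical mean and the mean squared deviation of the features of class $k$. Then for every $\delta>0$, if $\mathcal D\sim\mathbb P^N$, with probability at least $1-\delta$ the following bound holds simultaneously for all $f\in\mathcal F$: $$\mathcal R(f)\le\frac1{\ln2}\widehat{\mathcal R}^{\boldsymbol\gamma,\mathsf{ce}}_{\mathcal D}(f)+\frac{4\sqrt2\,\Lambda K}{\sqrt N}\sqrt{\sum_{k=1}^K\frac{\|\hat\mu_k\|_2^2+\|\hat s_k\|_2^2}{\gamma_k^2}}+3\sqrt{\frac{\ln(2/\delta)}{2N}}.$$ Moreover, if $K\mid N$, the same bound holds for all $f\in\mathcal F$ with conditional probability at least $1-\delta$ given that the sample is class-balanced, i.e. given $|I_k|=N/K$ for all $k\in[K]$. -/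

import Mathlib

open MeasureTheory ProbabilityTheory
open scoped BigOperators ENNReal

noncomputable section

namespace MarginBound

variable {X : Type*} {K d N : ℕ}

/-- Linear heads on top of the fixed encoder `φ`: all score functions `f(x,y) = ⟪w_y, φ x⟫`
with `‖w_y‖₂ ≤ Λ` for every class `y`. -/
def linearHeads (φ : X → EuclideanSpace ℝ (Fin d)) (K : ℕ) (Λ : ℝ) : Set (X → Fin K → ℝ) :=
  {f | ∃ w : Fin K → EuclideanSpace ℝ (Fin d),
    (∀ y, ‖w y‖ ≤ Λ) ∧ ∀ x y, f x y = inner ℝ (w y) (φ x)}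

/-- `amax` is an argmax rule: it picks an index of a largest coordinate (ties broken in any
way whatsoever). -/
def IsArgmax (amax : (Fin K → ℝ) → Fin K) : Prop :=
  ∀ (z : Fin K → ℝ) (k : Fin K), z k ≤ z (amax z)

/-- The 0-1 risk of `f` under `P`: the probability that the predicted label `amax (f x)`
differs from the label `y`. -/
def risk [MeasurableSpace X] (P : Measure (X × Fin K)) (amax : (Fin K → ℝ) → Fin K)
    (f : X → Fin K → ℝ) : ℝ :=
  P.real {p | p.2 ≠ amax (f p.1)}

/-- The softmax of a vector of logits. -/
def softmax (z : Fin K → ℝ) : Fin K → ℝ :=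
  fun k => Real.exp (z k) / ∑ j, Real.exp (z j)

/-- The `γ`-margin cross-entropy loss of `f` at `(x,y)`: minus the logarithm of the `y`-th
coordinate of `softmax (z / γ_y)`, where `z = f x` is the vector of logits. -/
def ceLoss (γ : Fin K → ℝ) (f : X → Fin K → ℝ) (x : X) (y : Fin K) : ℝ :=
  -Real.log (softmax (fun k => f x k / γ y) y)

/-- The empirical `γ`-margin cross-entropy risk on the sample `D`. -/
def ceRisk (γ : Fin K → ℝ) (D : Fin N → X × Fin K) (f : X → Fin K → ℝ) : ℝ :=
  (1 / (N : ℝ)) * ∑ i, ceLoss γ f (D i).1 (D i).2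

/-- The indices of the examples of class `k`. -/
def classIdx (D : Fin N → X × Fin K) (k : Fin K) : Finset (Fin N) :=
  Finset.univ.filter fun i => (D i).2 = k

/-- The empirical mean of the features of class `k` (the zero vector if the class does not
occur in the sample). -/
def classMean (φ : X → EuclideanSpace ℝ (Fin d)) (D : Fin N → X × Fin K) (k : Fin K) :
    EuclideanSpace ℝ (Fin d) :=
  (1 / ((classIdx D k).card : ℝ)) • ∑ i ∈ classIdx D k, φ (D i).1

/-- The empirical mean squared deviation of the features of class `k` from their mean (zero
if the class does not occur in the sample). -/
def classMSD (φ : X → EuclideanSpace ℝ (Fin d)) (D : Fin N → X × Fin K) (k : Fin K) : ℝ :=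
  (1 / ((classIdx D k).card : ℝ)) * ∑ i ∈ classIdx D k, ‖φ (D i).1 - classMean φ D k‖ ^ 2

/-- The sample is class-balanced: every class has exactly `N / K` examples. -/
def IsBalanced (D : Fin N → X × Fin K) : Prop :=
  ∀ k, ((classIdx D k).card : ℝ) = (N : ℝ) / (K : ℝ)

/-- The right-hand side of the class-sensitive margin bound at `f` and the sample `D`. -/
def marginBound (φ : X → EuclideanSpace ℝ (Fin d)) (γ : Fin K → ℝ) (Λ δ : ℝ)
    (D : Fin N → X × Fin K) (f : X → Fin K → ℝ) : ℝ :=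
  (1 / Real.log 2) * ceRisk γ D f
    + (4 * Real.sqrt 2 * Λ * (K : ℝ) / Real.sqrt (N : ℝ))
      * Real.sqrt (∑ k, (‖classMean φ D k‖ ^ 2 + classMSD φ D k) / γ k ^ 2)
    + 3 * Real.sqrt (Real.log (2 / δ) / (2 * (N : ℝ)))

end MarginBound

end

/-!
The 0-1 loss is at most the ramp loss of the normalized margins
`(f(x,y) - f(x,k)) / γ_y`, and the ramp loss is at most the cross-entropy divided by `ln 2`
(`rampLoss_le_neg_log_softmax_div`; for the binary logistic loss this is the concavity of `log`).
So it suffices to bound, uniformly over the heads, the deviation of the empirical ramp risk from its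
expectation.

`maxDeviation - 2 * rademacherSum` has nonpositive mean by symmetrization
(`integral_maxDeviation_le`) and bounded differences `3`, both quantities being sums over the sample
rather than averages. One application of McDiarmid's inequality
(`hasSubgaussianMGF_pi_of_bounded_differences`) therefore gives
`maxDeviation ≤ 2 * rademacherSum + 3 √(N ln(2/δ)/2)` outside an event of probability at most
`δ / 2` (`measure_maxDeviation_ge_le`).

The Rademacher average is estimated for a fixed sample. As a function of the scores
`⟪w_k, φ(x_i)⟫ / γ_{y_i}`, `k ∈ [K]`, the ramp loss is `2`-Lipschitz for the sup norm, and a Rademacher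
sum `∑ τ_k v_k` satisfies `E|∑ τ_k v_k| ≥ max_k |v_k|`; this lets one replace the losses by twice the
Rademacher sums of the scores, one example at a time (`expect_ciSup_add_sum_le`). The supremum over
the heads is then a sum over `k` of norms of Rademacher sums of the vectors `φ(x_i) / γ_{y_i}`, each of
expectation at most `√(∑_i ‖φ(x_i)‖² / γ_{y_i}²)` (`rademacherSum_headLoss_le`). Sorting that sum by
classes and bounding each class size by `N` yields the means and mean squared deviations in the
bound, with `4` in place of `4√2`.

Nothing in this uses that the examples are identically distributed: it is enough that they are
independent with laws summing to `N • P` (`MarginBound.pi_measure_not_forall_le`). Given a balanced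
vector of labels, the examples are independent with the class conditionals of `P` as laws, and these
sum to `N • P` because the priors are equal (`MarginBound.sum_cond_label`). Averaging over the balanced
label vectors gives the conditional statement.
-/

/-! ### Rademacher averages -/

section Rademacher

open Finset

theorem expect_eq_half_expect_add_neg {S : Type*} [Fintype S] [InvolutiveNeg S] (F : S → ℝ) :
    𝔼 s, F s = 𝔼 s, (F s + F (-s)) / 2 := by
  have h : 𝔼 s, F (-s) = 𝔼 s, F s :=
    Fintype.expect_equiv (Equiv.neg S) _ _ fun _ => rfl
  rw [← expect_div, expect_add_distrib, h]
  ring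

theorem expect_fin_cons {S : Type*} [Fintype S] {n : ℕ} (F : (Fin (n + 1) → S) → ℝ) :
    𝔼 σ, F σ = 𝔼 σ : Fin n → S, 𝔼 s, F (Fin.cons s σ) := by
  rw [expect_comm, ← expect_product' (f := fun s (σ : Fin n → S) => F (Fin.cons s σ)),
    univ_product_univ]
  exact (Fintype.expect_equiv (Fin.consEquiv fun _ => S) _ _ fun _ => rfl).symm

theorem units_int_abs (e : ℤˣ) : |((e : ℤ) : ℝ)| = 1 := by
  rcases Int.units_eq_one_or e with rfl | rfl <;> simp

/-- A Rademacher sum is on average at least as large as each of its coefficients. -/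
theorem abs_le_expect_abs_sum {κ : Type*} [Fintype κ] [DecidableEq κ] (v : κ → ℝ) (j : κ) :
    |v j| ≤ 𝔼 τ : κ → ℤˣ, |∑ k, ((τ k : ℤ) : ℝ) * v k| := by
  -- Flipping every sign but the `j`-th cancels all terms except the `j`-th one.
  let flip : (κ → ℤˣ) ≃ (κ → ℤˣ) := Function.Involutive.toPerm
    (fun τ k => if k = j then τ k else -τ k) (by intro τ; funext k; by_cases h : k = j <;> simp [h])
  have h := Fintype.expect_equiv flip (fun τ => |∑ k, ((flip τ k : ℤ) : ℝ) * v k|)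
    (fun τ => |∑ k, ((τ k : ℤ) : ℝ) * v k|) fun _ => rfl
  have h2 : 𝔼 τ : κ → ℤˣ, |v j| ≤ 𝔼 τ : κ → ℤˣ, (|∑ k, ((τ k : ℤ) : ℝ) * v k|
      + |∑ k, ((flip τ k : ℤ) : ℝ) * v k|) / 2 := by
    refine expect_le_expect fun τ _ => ?_
    have : ∑ k, ((τ k : ℤ) : ℝ) * v k + ∑ k, ((flip τ k : ℤ) : ℝ) * v k
        = 2 * (((τ j : ℤ) : ℝ) * v j) := by
      rw [← sum_add_distrib, Finset.sum_eq_single j]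
      · simp [flip, Function.Involutive.toPerm]; ring
      · intro k _ hk
        simp [flip, Function.Involutive.toPerm, hk]
      · simp
    have h3 := abs_add_le (∑ k, ((τ k : ℤ) : ℝ) * v k) (∑ k, ((flip τ k : ℤ) : ℝ) * v k)
    rw [this, abs_mul, abs_mul, units_int_abs] at h3
    norm_num at h3
    linarith
  rw [← expect_div, expect_add_distrib, h, Fintype.expect_const] at h2
  linarith

/-- The second moment of a vector-valued Rademacher sum whose signs are column `k` of a matrix of
independent signs. -/
theorem expect_norm_add_sum_sq {E κ : Type*} [NormedAddCommGroup E] [InnerProductSpace ℝ E]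
    [Fintype κ] [DecidableEq κ] (k : κ) {n : ℕ} (v : Fin n → E) (x : E) :
    𝔼 τ : Fin n → κ → ℤˣ, ‖x + ∑ i, ((τ i k : ℤ) : ℝ) • v i‖ ^ 2
      = ‖x‖ ^ 2 + ∑ i, ‖v i‖ ^ 2 := by
  induction n generalizing x with
  | zero => simp
  | succ n ih =>
    rw [expect_fin_cons, expect_comm]
    simp_rw [Fin.sum_univ_succ, Fin.cons_zero, Fin.cons_succ, ← add_assoc]
    simp_rw [ih]
    rw [expect_eq_half_expect_add_neg]
    have : ∀ s : κ → ℤˣ, (‖x + ((s k : ℤ) : ℝ) • v 0‖ ^ 2 + ∑ i : Fin n, ‖v i.succ‖ ^ 2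
        + (‖x + (((-s) k : ℤ) : ℝ) • v 0‖ ^ 2 + ∑ i : Fin n, ‖v i.succ‖ ^ 2)) / 2
        = ‖x‖ ^ 2 + ‖v 0‖ ^ 2 + ∑ i : Fin n, ‖v i.succ‖ ^ 2 := by
      intro s
      have h := parallelogram_law_with_norm ℝ x (((s k : ℤ) : ℝ) • v 0)
      rw [norm_smul, Real.norm_eq_abs, units_int_abs, one_mul] at h
      simp only [Pi.neg_apply, Units.val_neg, Int.cast_neg, neg_smul, ← sub_eq_add_neg]
      linarith
    simp_rw [this, Fintype.expect_const]

theorem expect_norm_sum_le {E κ : Type*} [NormedAddCommGroup E] [InnerProductSpace ℝ E]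
    [Fintype κ] [DecidableEq κ] (k : κ) {n : ℕ} (v : Fin n → E) :
    𝔼 τ : Fin n → κ → ℤˣ, ‖∑ i, ((τ i k : ℤ) : ℝ) • v i‖ ≤ √(∑ i, ‖v i‖ ^ 2) := by
  refine Real.le_sqrt_of_sq_le ?_
  have h := expect_norm_add_sum_sq k v 0
  simp only [zero_add, norm_zero, ne_eq, OfNat.ofNat_ne_zero, not_false_eq_true, zero_pow] at h
  rw [← h]
  set a := 𝔼 τ : Fin n → κ → ℤˣ, ‖∑ i, ((τ i k : ℤ) : ℝ) • v i‖
  -- Jensen's inequality for the square: the variance is nonnegative.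
  have h0 : 0 ≤ 𝔼 τ : Fin n → κ → ℤˣ, (‖∑ i, ((τ i k : ℤ) : ℝ) • v i‖ - a) ^ 2 :=
    expect_nonneg fun _ _ => sq_nonneg _
  simp_rw [sub_sq, expect_add_distrib, expect_sub_distrib, ← expect_mul, ← mul_expect,
    Fintype.expect_const] at h0
  change 0 ≤ _ - 2 * a * a + a ^ 2 at h0
  linarith

variable {T : Type*} [Nonempty T]

/-- One step of the contraction principle. Two competitors `s`, `t` for the suprema on the left
differ by at most twice a single coordinate of `u s - u t`, which `abs_le_expect_abs_sum` bounds by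
an average of Rademacher sums. -/
theorem ciSup_add_ciSup_sub_le {κ : Type*} [Fintype κ] [DecidableEq κ] (G a : T → ℝ) (u : κ → T → ℝ)
    (hG : ∃ C, ∀ t, |G t| ≤ C) (hu : ∀ k, ∃ C, ∀ t, |u k t| ≤ C)
    (h : ∀ s t, ∃ k, |a s - a t| ≤ 2 * |u k s - u k t|) :
    ((⨆ t, (G t + a t)) + ⨆ t, (G t - a t)) / 2
      ≤ 𝔼 τ : κ → ℤˣ, ⨆ t, (G t + 2 * ∑ k, ((τ k : ℤ) : ℝ) * u k t) := by
  obtain ⟨C, hC⟩ := hG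
  choose D hD using hu
  have hbdd : ∀ τ : κ → ℤˣ,
      BddAbove (Set.range fun t => G t + 2 * ∑ k, ((τ k : ℤ) : ℝ) * u k t) := by
    intro τ
    refine ⟨C + 2 * ∑ k, D k, ?_⟩
    rintro _ ⟨t, rfl⟩
    have h1 : ∑ k, ((τ k : ℤ) : ℝ) * u k t ≤ ∑ k, D k := by
      refine sum_le_sum fun k _ => (le_abs_self _).trans ?_
      rw [abs_mul, units_int_abs, one_mul]
      exact hD k t
    have := (le_abs_self _).trans (hC t)
    dsimp only
    linarith
  set A := 𝔼 τ : κ → ℤˣ, ⨆ t, (G t + 2 * ∑ k, ((τ k : ℤ) : ℝ) * u k t) with hA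
  have key : ∀ s t, G s + a s + (G t - a t) ≤ 2 * A := by
    intro s t
    obtain ⟨k, hk⟩ := h s t
    have h1 := abs_le_expect_abs_sum (fun k => u k s - u k t) k
    have h2 : 𝔼 τ : κ → ℤˣ, ((G s + G t) / 2 + |∑ k, ((τ k : ℤ) : ℝ) * (u k s - u k t)|) ≤ A := by
      rw [hA, expect_eq_half_expect_add_neg (fun τ : κ → ℤˣ =>
        ⨆ t, (G t + 2 * ∑ k, ((τ k : ℤ) : ℝ) * u k t))]
      refine expect_le_expect fun τ _ => ?_
      have e1 := le_ciSup (hbdd τ) s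
      have e2 := le_ciSup (hbdd τ) t
      have e3 := le_ciSup (hbdd (-τ)) s
      have e4 := le_ciSup (hbdd (-τ)) t
      simp only [Pi.neg_apply, Units.val_neg, Int.cast_neg, neg_mul, sum_neg_distrib] at e1 e2 e3 e4 ⊢
      simp_rw [mul_sub, sum_sub_distrib]
      rcases abs_cases (∑ k, ((τ k : ℤ) : ℝ) * u k s - ∑ k, ((τ k : ℤ) : ℝ) * u k t) with
        ⟨h, _⟩ | ⟨h, _⟩ <;> rw [h] <;> linarith
    rw [expect_add_distrib, Fintype.expect_const] at h2
    have := (le_abs_self _).trans hk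
    linarith
  have h1 : ∀ t, (⨆ s, (G s + a s)) ≤ 2 * A - (G t - a t) := fun t =>
    ciSup_le fun s => by linarith [key s t]
  have h2 : (⨆ t, (G t - a t)) ≤ 2 * A - ⨆ s, (G s + a s) :=
    ciSup_le fun t => by linarith [h1 t]
  linarith

/-- **Contraction principle.** A function of the vector `(u i k)_k` that is `2`-Lipschitz for the
sup norm may be replaced, one index `i` at a time, by twice a Rademacher sum of the coordinates. -/
theorem expect_ciSup_add_sum_le {κ : Type*} [Fintype κ] [DecidableEq κ] {n : ℕ} (G : T → ℝ)
    (a : Fin n → T → ℝ) (u : Fin n → κ → T → ℝ)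
    (hG : ∃ C, ∀ t, |G t| ≤ C) (ha : ∀ i, ∃ C, ∀ t, |a i t| ≤ C)
    (hu : ∀ i k, ∃ C, ∀ t, |u i k t| ≤ C)
    (h : ∀ i s t, ∃ k, |a i s - a i t| ≤ 2 * |u i k s - u i k t|) :
    𝔼 σ : Fin n → ℤˣ, ⨆ t, (G t + ∑ i, ((σ i : ℤ) : ℝ) * a i t)
      ≤ 𝔼 τ : Fin n → κ → ℤˣ, ⨆ t, (G t + 2 * ∑ i, ∑ k, ((τ i k : ℤ) : ℝ) * u i k t) := by
  induction n generalizing G with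
  | zero => simp
  | succ n ih =>
    obtain ⟨C, hC⟩ := hG
    choose B hB using ha
    choose D hD using hu
    have step1 : 𝔼 σ : Fin (n + 1) → ℤˣ, ⨆ t, (G t + ∑ i, ((σ i : ℤ) : ℝ) * a i t)
        ≤ 𝔼 σ : Fin n → ℤˣ, 𝔼 s : κ → ℤˣ, ⨆ t, (G t + 2 * ∑ k, ((s k : ℤ) : ℝ) * u 0 k t
            + ∑ i : Fin n, ((σ i : ℤ) : ℝ) * a i.succ t) := by
      rw [expect_fin_cons]
      refine expect_le_expect fun σ _ => ?_
      simp_rw [Fin.sum_univ_succ, Fin.cons_zero, Fin.cons_succ]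
      have hb : ∀ t, |G t + ∑ i : Fin n, ((σ i : ℤ) : ℝ) * a i.succ t|
          ≤ C + ∑ i : Fin n, B i.succ := by
        intro t
        refine (abs_add_le _ _).trans (add_le_add (hC t) ((abs_sum_le_sum_abs _ _).trans ?_))
        refine sum_le_sum fun i _ => ?_
        rw [abs_mul, units_int_abs, one_mul]
        exact hB _ t
      have := ciSup_add_ciSup_sub_le (fun t => G t + ∑ i : Fin n, ((σ i : ℤ) : ℝ) * a i.succ t)
        (a 0) (u 0) ⟨_, hb⟩ (fun k => ⟨_, hD 0 k⟩) (h 0)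
      refine le_trans (le_of_eq ?_) (this.trans (le_of_eq ?_))
      · rw [expect_eq_half_expect_add_neg]
        rw [← Fintype.expect_const (ι := ℤˣ) (((⨆ t, (G t +
          ∑ i : Fin n, ((σ i : ℤ) : ℝ) * a i.succ t + a 0 t)) + _) / 2)]
        refine expect_congr rfl fun e _ => ?_
        rcases Int.units_eq_one_or e with rfl | rfl
        · simp only [Units.val_one, Int.cast_one, one_mul, Units.val_neg, Int.cast_neg, neg_mul]
          congr! 4 <;> ring
        · simp only [Units.val_one, Int.cast_one, one_mul, Units.val_neg, Int.cast_neg, neg_mul,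
            neg_neg]
          rw [add_comm]
          congr! 4 <;> ring
      · refine expect_congr rfl fun s _ => ?_
        congr! 2
        ring
    refine step1.trans ?_
    rw [expect_comm, expect_fin_cons, expect_comm (s := (univ : Finset (Fin n → κ → ℤˣ)))]
    refine expect_le_expect fun s _ => ?_
    have hb : ∀ t, |G t + 2 * ∑ k, ((s k : ℤ) : ℝ) * u 0 k t| ≤ C + 2 * ∑ k, D 0 k := by
      intro t
      refine (abs_add_le _ _).trans (add_le_add (hC t) ?_)
      rw [abs_mul, abs_two]
      refine mul_le_mul_of_nonneg_left ((abs_sum_le_sum_abs _ _).trans ?_) zero_le_two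
      refine sum_le_sum fun i _ => ?_
      rw [abs_mul, units_int_abs, one_mul]
      exact hD _ _ t
    refine (ih (fun t => G t + 2 * ∑ k, ((s k : ℤ) : ℝ) * u 0 k t) (fun i => a i.succ)
      (fun i => u i.succ) ⟨_, hb⟩ (fun i => ⟨_, hB i.succ⟩) (fun i k => ⟨_, hD i.succ k⟩)
      (fun i => h i.succ)).trans (le_of_eq ?_)
    refine expect_congr rfl fun τ _ => ?_
    simp_rw [Fin.sum_univ_succ, Fin.cons_zero, Fin.cons_succ]
    congr! 2
    ring

end Rademacher

/-! ### The bounded differences inequality -/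

section BoundedDifferences

variable {Z : Type*} [MeasurableSpace Z]

/-- **McDiarmid's inequality**, in moment generating function form: a bounded function of `n`
independent variables that moves by at most `c` when one of them is changed is sub-Gaussian with
variance proxy `n c² / 4`. Hoeffding's lemma is applied to one variable at a time. -/
theorem hasSubgaussianMGF_pi_of_bounded_differences {n : ℕ} (μ : Fin n → Measure Z)
    [∀ i, IsProbabilityMeasure (μ i)] (g : (Fin n → Z) → ℝ) (hg : Measurable g)
    (C : ℝ) (hC : ∀ D, |g D| ≤ C) (c : NNReal)
    (h : ∀ D i z, |g D - g (Function.update D i z)| ≤ c) :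
    HasSubgaussianMGF (fun D => g D - ∫ D', g D' ∂(Measure.pi μ)) (n * (c / 2) ^ 2)
      (Measure.pi μ) := by
  induction n with
  | zero =>
    have : (fun D => g D - ∫ D', g D' ∂(Measure.pi μ)) = fun _ => 0 := by
      funext D
      have : ∀ D', g D' = g D := fun D' => by rw [Subsingleton.elim D' D]
      simp [this]
    rw [this]
    constructor
    · intro t; simp
    · intro t; simp [mgf]
  | succ n ih =>
    set ν := Measure.pi μ with hν
    set ν' : Measure (Fin n → Z) := Measure.pi fun i => μ i.succ with hν'
    have he : MeasurePreserving (MeasurableEquiv.piFinSuccAbove (fun _ => Z) 0).symm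
        ((μ 0).prod ν') ν := (measurePreserving_piFinSuccAbove μ 0).symm
    have hcons : ∀ p : Z × (Fin n → Z),
        (MeasurableEquiv.piFinSuccAbove (fun _ => Z) 0).symm p = Fin.cons p.1 p.2 := by
      intro p
      simp [MeasurableEquiv.piFinSuccAbove, Fin.insertNthEquiv]
    have hge : Measurable fun p : Z × (Fin n → Z) => g (Fin.cons p.1 p.2) := by
      simp_rw [← hcons]
      exact hg.comp he.measurable
    have hint : ∀ {Ω : Type _} [MeasurableSpace Ω] (ρ : Measure Ω) [IsProbabilityMeasure ρ]
        (f : Ω → ℝ), Measurable f → (∃ B, ∀ x, |f x| ≤ B) → Integrable f ρ := by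
      rintro Ω _ ρ _ f hf ⟨B, hB⟩
      exact Integrable.of_bound hf.aestronglyMeasurable B (ae_of_all _ hB)
    let m : Z → ℝ := fun z => ∫ D', g (Fin.cons z D') ∂ν'
    have hm : Measurable m := hge.stronglyMeasurable.integral_prod_right.measurable
    have hgz : ∀ z, Measurable fun D' : Fin n → Z => g (Fin.cons z D') :=
      fun z => hge.comp measurable_prodMk_left
    have hgi : ∀ z, Integrable (fun D' : Fin n → Z => g (Fin.cons z D')) ν' := fun z =>
      hint _ _ (hgz z) ⟨C, fun _ => hC _⟩
    have hmC : ∀ z, |m z| ≤ C := fun z => by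
      have := norm_integral_le_of_norm_le_const (μ := ν') (C := C)
        (f := fun D' => g (Fin.cons z D')) (ae_of_all _ fun D' => hC _)
      simpa using this
    have hmm : ∀ z z', m z - m z' ≤ c := by
      intro z z'
      rw [← integral_sub (hgi z) (hgi z')]
      have := integral_mono (μ := ν') ((hgi z).sub (hgi z')) (integrable_const (c : ℝ))
        (fun D' => ?_)
      · simpa using this
      · have := (le_abs_self _).trans (h (Fin.cons z D') 0 z')
        simpa [Fin.update_cons_zero] using this
    have hEm : ∫ z, m z ∂(μ 0) = ∫ D, g D ∂ν := by
      rw [← he.integral_comp' g]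
      simp_rw [hcons]
      exact (integral_prod _ (hint _ _ hge ⟨C, fun _ => hC _⟩)).symm
    obtain ⟨z₀⟩ : Nonempty Z := (μ 0).nonempty_of_neZero
    have hbb : BddBelow (Set.range m) := ⟨-C, by
      rintro _ ⟨z, rfl⟩; exact (abs_le.1 (hmC z)).1⟩
    -- Averaging over the other variables keeps the bounded difference, so `m` has range in an
    -- interval of length `c`.
    have hmI : ∀ z, m z ∈ Set.Icc (⨅ z, m z) ((⨅ z, m z) + c) := by
      intro z
      have : Nonempty Z := ⟨z₀⟩
      refine ⟨ciInf_le hbb z, ?_⟩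
      have : m z - c ≤ ⨅ z, m z := le_ciInf fun z' => by linarith [hmm z z']
      linarith
    have hsub0 : HasSubgaussianMGF (fun z => m z - ∫ z, m z ∂(μ 0)) ((c / 2) ^ 2) (μ 0) := by
      have := hasSubgaussianMGF_of_mem_Icc (μ := μ 0) hm.aemeasurable (ae_of_all _ hmI)
      simpa using this
    have hsub : ∀ z, HasSubgaussianMGF (fun D' => g (Fin.cons z D') - m z) (n * (c / 2) ^ 2) ν' :=
      fun z => ih (fun i => μ i.succ) (fun D' => g (Fin.cons z D')) (hgz z) (fun D' => hC _)
        (fun D' i x => by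
          have := h (Fin.cons z D') i.succ x
          rwa [← Fin.cons_update] at this)
    constructor
    · intro t
      refine hint _ _ (by fun_prop) ⟨Real.exp (|t| * (C + |∫ D', g D' ∂ν|)), fun D => ?_⟩
      rw [Real.abs_exp]
      refine Real.exp_le_exp.2 ((le_abs_self _).trans ?_)
      rw [abs_mul]
      gcongr
      exact (abs_sub _ _).trans (by gcongr; exact hC D)
    · intro t
      have hexp : Integrable (fun p : Z × (Fin n → Z) =>
          Real.exp (t * (g (Fin.cons p.1 p.2) - ∫ D, g D ∂ν))) ((μ 0).prod ν') := by
        refine hint _ _ (((hge.sub_const _).const_mul t).exp)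
          ⟨Real.exp (|t| * (C + |∫ D', g D' ∂ν|)), fun D => ?_⟩
        rw [Real.abs_exp]
        refine Real.exp_le_exp.2 ((le_abs_self _).trans ?_)
        rw [abs_mul]
        gcongr
        exact (abs_sub _ _).trans (by gcongr; exact hC _)
      have h1 : mgf (fun D => g D - ∫ D', g D' ∂ν) ν t
          = ∫ z, Real.exp (t * (m z - ∫ D, g D ∂ν))
            * mgf (fun D' => g (Fin.cons z D') - m z) ν' t ∂(μ 0) := by
        unfold mgf
        rw [← he.integral_comp' (fun D => Real.exp (t * (g D - ∫ D', g D' ∂ν)))]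
        simp_rw [hcons]
        refine (integral_prod _ hexp).trans ?_
        refine integral_congr_ae (ae_of_all _ fun z => ?_)
        dsimp only
        rw [← integral_const_mul]
        refine integral_congr_ae (ae_of_all _ fun D' => ?_)
        dsimp only
        rw [← Real.exp_add]
        congr 1
        ring
      rw [h1]
      have hsub0' := hsub0
      rw [hEm] at hsub0'
      calc _ ≤ ∫ z, Real.exp (t * (m z - ∫ D, g D ∂ν))
            * Real.exp ((n * (c / 2) ^ 2 : NNReal) * t ^ 2 / 2) ∂(μ 0) := by
            refine integral_mono_of_nonneg (ae_of_all _ fun z => ?_)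
              ((hsub0'.integrable_exp_mul t).mul_const _) (ae_of_all _ fun z => ?_)
            · exact mul_nonneg (Real.exp_pos _).le mgf_nonneg
            · exact mul_le_mul_of_nonneg_left ((hsub z).mgf_le t) (Real.exp_pos _).le
        _ ≤ Real.exp (((c / 2) ^ 2 : NNReal) * t ^ 2 / 2)
            * Real.exp ((n * (c / 2) ^ 2 : NNReal) * t ^ 2 / 2) := by
            rw [integral_mul_const]
            exact mul_le_mul_of_nonneg_right (hsub0'.mgf_le t) (Real.exp_pos _).le
        _ = _ := by
            rw [← Real.exp_add]
            congr 1
            push_cast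
            ring

end BoundedDifferences

/-! ### Symmetrization and the uniform deviation bound -/

section Symmetrization

open Finset

theorem abs_ciSup_sub_ciSup_le {T : Type*} [Nonempty T] {F G : T → ℝ} {C c : ℝ}
    (hF : ∀ t, |F t| ≤ C) (hG : ∀ t, |G t| ≤ C) (h : ∀ t, |F t - G t| ≤ c) :
    |(⨆ t, F t) - ⨆ t, G t| ≤ c := by
  have bF : BddAbove (Set.range F) := ⟨C, by rintro _ ⟨t, rfl⟩; exact (abs_le.1 (hF t)).2⟩
  have bG : BddAbove (Set.range G) := ⟨C, by rintro _ ⟨t, rfl⟩; exact (abs_le.1 (hG t)).2⟩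
  have h1 : (⨆ t, F t) ≤ (⨆ t, G t) + c := ciSup_le fun t => by
    linarith [le_ciSup bG t, (abs_le.1 (h t)).2]
  have h2 : (⨆ t, G t) ≤ (⨆ t, F t) + c := ciSup_le fun t => by
    linarith [le_ciSup bF t, (abs_le.1 (h t)).1]
  rw [abs_le]
  constructor <;> linarith

theorem abs_ciSup_le {T : Type*} [Nonempty T] {F : T → ℝ} {C : ℝ} (hF : ∀ t, |F t| ≤ C) :
    |⨆ t, F t| ≤ C := by
  have hC : 0 ≤ C := (abs_nonneg _).trans (hF (Classical.arbitrary T))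
  simpa using abs_ciSup_sub_ciSup_le (G := fun _ => 0) hF (by simpa using hC) (by simpa using hF)

theorem abs_expect_le_of_abs_le {ι : Type*} [Fintype ι] [Nonempty ι] {f : ι → ℝ} {C : ℝ}
    (h : ∀ i, |f i| ≤ C) : |𝔼 i, f i| ≤ C :=
  (abs_expect_le _ _).trans
    ((expect_le_expect fun i _ => h i).trans (Fintype.expect_const C).le)

theorem abs_sum_sub_sum_update_le {Z : Type*} {n : ℕ} {c : ℝ} (f : Fin n → Z → ℝ)
    (D : Fin n → Z) (i : Fin n) (z : Z) (h : ∀ z z', |f i z - f i z'| ≤ c) :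
    |∑ j, f j (D j) - ∑ j, f j (Function.update D i z j)| ≤ c := by
  rw [← sum_sub_distrib, Finset.sum_eq_single i]
  · exact h _ _
  · intro j _ hj
    simp [hj]
  · simp

variable {T Z : Type*} {n : ℕ}

/-- The empirical Rademacher average of the losses `ℓ t` on the sample `D`, without the factor
`1 / n`. -/
noncomputable def rademacherSum (ℓ : T → Z → ℝ) (D : Fin n → Z) : ℝ :=
  𝔼 σ : Fin n → ℤˣ, ⨆ t, ∑ i, ((σ i : ℤ) : ℝ) * ℓ t (D i)

/-- The largest excess over `t` of the expected sum of losses over the sum of losses on the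
sample `D`, whose `i`-th entry is distributed as `μ i`. -/
noncomputable def maxDeviation [MeasurableSpace Z] (μ : Fin n → Measure Z) (ℓ : T → Z → ℝ)
    (D : Fin n → Z) : ℝ :=
  ⨆ t, ∑ i, (∫ z, ℓ t z ∂(μ i) - ℓ t (D i))

theorem abs_sum_le_card {f : Fin n → ℝ} (h : ∀ i, |f i| ≤ 1) : |∑ i, f i| ≤ n := by
  refine (abs_sum_le_sum_abs _ _).trans ((sum_le_sum fun i _ => h i).trans ?_)
  simp

theorem abs_sign_mul_le {x : ℝ} (e : ℤˣ) (h0 : 0 ≤ x) (h1 : x ≤ 1) :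
    |((e : ℤ) : ℝ) * x| ≤ 1 := by
  rw [abs_mul, units_int_abs, one_mul, abs_of_nonneg h0]
  exact h1

section Bounds

variable [Nonempty T] {ℓ : T → Z → ℝ} (h0 : ∀ t z, 0 ≤ ℓ t z) (h1 : ∀ t z, ℓ t z ≤ 1)
include h0 h1

theorem abs_rademacherSum_le (D : Fin n → Z) : |rademacherSum ℓ D| ≤ n :=
  abs_expect_le_of_abs_le fun _ => abs_ciSup_le fun _ =>
    abs_sum_le_card fun _ => abs_sign_mul_le _ (h0 _ _) (h1 _ _)

theorem abs_rademacherSum_sub_update_le (D : Fin n → Z) (i : Fin n) (z : Z) :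
    |rademacherSum ℓ D - rademacherSum ℓ (Function.update D i z)| ≤ 1 := by
  unfold rademacherSum
  rw [← expect_sub_distrib]
  refine abs_expect_le_of_abs_le fun σ => abs_ciSup_sub_ciSup_le (C := n)
    (fun t => abs_sum_le_card fun i => abs_sign_mul_le _ (h0 _ _) (h1 _ _))
    (fun t => abs_sum_le_card fun i => abs_sign_mul_le _ (h0 _ _) (h1 _ _)) fun t => ?_
  refine abs_sum_sub_sum_update_le (fun j z => ((σ j : ℤ) : ℝ) * ℓ t z) D i z fun z z' => ?_
  rw [← mul_sub, abs_mul, units_int_abs, one_mul, abs_le]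
  constructor <;> linarith [h0 t z, h0 t z', h1 t z, h1 t z']

variable [MeasurableSpace Z] (hm : ∀ t, Measurable (ℓ t)) (μ : Fin n → Measure Z)
  [∀ i, IsProbabilityMeasure (μ i)]
include hm

omit [Nonempty T] in
theorem integrable_of_mem_unitInterval (ρ : Measure Z) [IsFiniteMeasure ρ] (t : T) :
    Integrable (ℓ t) ρ :=
  Integrable.of_bound (hm t).aestronglyMeasurable 1 (ae_of_all _ fun z => by
    rw [Real.norm_eq_abs, abs_of_nonneg (h0 t z)]; exact h1 t z)

omit [Nonempty T] in
theorem abs_integral_sub_le (t : T) (i : Fin n) (z : Z) : |∫ z, ℓ t z ∂(μ i) - ℓ t z| ≤ 1 := by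
  have a0 : 0 ≤ ∫ z, ℓ t z ∂(μ i) := integral_nonneg (h0 t)
  have a1 : ∫ z, ℓ t z ∂(μ i) ≤ 1 := by
    simpa using integral_mono (integrable_of_mem_unitInterval h0 h1 hm (μ i) t)
      (integrable_const 1) (h1 t)
  rw [abs_le]
  constructor <;> linarith [h0 t z, h1 t z]

theorem abs_maxDeviation_le (D : Fin n → Z) : |maxDeviation μ ℓ D| ≤ n :=
  abs_ciSup_le fun _ => abs_sum_le_card fun _ => abs_integral_sub_le h0 h1 hm μ _ _ _

omit [Nonempty T] in
theorem sum_integral_sub_le_maxDeviation (D : Fin n → Z) (t : T) :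
    ∑ i, (∫ z, ℓ t z ∂(μ i) - ℓ t (D i)) ≤ maxDeviation μ ℓ D :=
  le_ciSup (f := fun t => ∑ i, (∫ z, ℓ t z ∂(μ i) - ℓ t (D i))) ⟨n, by
    rintro _ ⟨t, rfl⟩
    exact (abs_le.1 (abs_sum_le_card fun _ => abs_integral_sub_le h0 h1 hm μ _ _ _)).2⟩ t

theorem abs_maxDeviation_sub_update_le (D : Fin n → Z) (i : Fin n) (z : Z) :
    |maxDeviation μ ℓ D - maxDeviation μ ℓ (Function.update D i z)| ≤ 1 := by
  refine abs_ciSup_sub_ciSup_le (C := n)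
    (fun t => abs_sum_le_card fun _ => abs_integral_sub_le h0 h1 hm μ _ _ _)
    (fun t => abs_sum_le_card fun _ => abs_integral_sub_le h0 h1 hm μ _ _ _) fun t => ?_
  refine abs_sum_sub_sum_update_le (fun j z => ∫ z, ℓ t z ∂(μ j) - ℓ t z) D i z fun z z' => ?_
  rw [sub_sub_sub_cancel_left, abs_le]
  constructor <;> linarith [h0 t z, h0 t z', h1 t z, h1 t z']

end Bounds

theorem measurable_signedSup [MeasurableSpace Z] [Countable T] {ℓ : T → Z → ℝ}
    (hm : ∀ t, Measurable (ℓ t)) (σ : Fin n → ℤˣ) :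
    Measurable fun D : Fin n → Z => ⨆ t, ∑ i, ((σ i : ℤ) : ℝ) * ℓ t (D i) :=
  Measurable.iSup fun t => Finset.measurable_sum _ fun i _ =>
    ((hm t).comp (measurable_pi_apply i)).const_mul _

theorem measurable_rademacherSum [MeasurableSpace Z] [Countable T] {ℓ : T → Z → ℝ}
    (hm : ∀ t, Measurable (ℓ t)) : Measurable (rademacherSum (n := n) ℓ) := by
  unfold rademacherSum
  simp_rw [Fintype.expect_eq_sum_div_card]
  exact (Finset.measurable_sum _ fun σ _ => measurable_signedSup hm σ).div_const _

theorem measurable_maxDeviation [MeasurableSpace Z] [Countable T] {ℓ : T → Z → ℝ}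
    (hm : ∀ t, Measurable (ℓ t)) (μ : Fin n → Measure Z) : Measurable (maxDeviation μ ℓ) :=
  Measurable.iSup fun t => Finset.measurable_sum _ fun i _ =>
    ((hm t).comp (measurable_pi_apply i)).const_sub _

/-- Exchanging the `i`-th entries of two independent copies of a sample, for every `i` with
`σ i = -1`. -/
def exchange (σ : Fin n → ℤˣ) (p : (Fin n → Z) × (Fin n → Z)) : (Fin n → Z) × (Fin n → Z) :=
  (fun i => if σ i = 1 then p.1 i else p.2 i, fun i => if σ i = 1 then p.2 i else p.1 i)

theorem measurePreserving_exchange [MeasurableSpace Z] (μ : Fin n → Measure Z)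
    [∀ i, IsProbabilityMeasure (μ i)] (σ : Fin n → ℤˣ) :
    MeasurePreserving (exchange (Z := Z) σ) ((Measure.pi μ).prod (Measure.pi μ))
      ((Measure.pi μ).prod (Measure.pi μ)) := by
  let s : Fin n → Z × Z → Z × Z := fun i => if σ i = 1 then id else Prod.swap
  have hs : ∀ i, MeasurePreserving (s i) ((μ i).prod (μ i)) ((μ i).prod (μ i)) := by
    intro i
    by_cases h : σ i = 1
    · simpa [s, h] using MeasurePreserving.id ((μ i).prod (μ i))
    · simpa [s, h] using Measure.measurePreserving_swap (μ := μ i) (ν := μ i)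
  have he := measurePreserving_arrowProdEquivProdArrow Z Z (Fin n) μ μ
  convert (he.comp (measurePreserving_pi _ _ hs)).comp
    (he.symm (MeasurableEquiv.arrowProdEquivProdArrow Z Z (Fin n))) using 1
  funext p
  refine Prod.ext ?_ ?_ <;> funext i <;> by_cases h : σ i = 1 <;>
    simp [exchange, s, h, MeasurableEquiv.arrowProdEquivProdArrow, Equiv.arrowProdEquivProdArrow]

/-- **Symmetrization**: the expected largest deviation is at most twice the expected Rademacher
average. -/
theorem integral_maxDeviation_le [MeasurableSpace Z] [Countable T] [Nonempty T] {ℓ : T → Z → ℝ}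
    (h0 : ∀ t z, 0 ≤ ℓ t z) (h1 : ∀ t z, ℓ t z ≤ 1)
    (hm : ∀ t, Measurable (ℓ t)) (μ : Fin n → Measure Z) [∀ i, IsProbabilityMeasure (μ i)] :
    ∫ D, maxDeviation μ ℓ D ∂(Measure.pi μ) ≤ 2 * ∫ D, rademacherSum ℓ D ∂(Measure.pi μ) := by
  set ν := Measure.pi μ with hν
  let H : (Fin n → Z) × (Fin n → Z) → ℝ := fun p => ⨆ t, ∑ i, (ℓ t (p.2 i) - ℓ t (p.1 i))
  let A : (Fin n → ℤˣ) → (Fin n → Z) → ℝ := fun σ D => ⨆ t, ∑ i, ((σ i : ℤ) : ℝ) * ℓ t (D i)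
  have hsub : ∀ (p : (Fin n → Z) × (Fin n → Z)) t, |∑ i, (ℓ t (p.2 i) - ℓ t (p.1 i))| ≤ n :=
    fun p t => abs_sum_le_card fun i => by
      rw [abs_le]
      constructor <;> linarith [h0 t (p.1 i), h0 t (p.2 i), h1 t (p.1 i), h1 t (p.2 i)]
  have hsum : ∀ (σ : Fin n → ℤˣ) (D : Fin n → Z) t, |∑ i, ((σ i : ℤ) : ℝ) * ℓ t (D i)| ≤ n :=
    fun σ D t => abs_sum_le_card fun i => abs_sign_mul_le _ (h0 _ _) (h1 _ _)
  have hHle : ∀ p t, ∑ i, (ℓ t (p.2 i) - ℓ t (p.1 i)) ≤ H p := fun p t =>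
    le_ciSup (f := fun t => ∑ i, (ℓ t (p.2 i) - ℓ t (p.1 i)))
      ⟨n, by rintro _ ⟨t, rfl⟩; exact (abs_le.1 (hsub p t)).2⟩ t
  have hAle : ∀ σ D t, ∑ i, ((σ i : ℤ) : ℝ) * ℓ t (D i) ≤ A σ D := fun σ D t =>
    le_ciSup (f := fun t => ∑ i, ((σ i : ℤ) : ℝ) * ℓ t (D i))
      ⟨n, by rintro _ ⟨t, rfl⟩; exact (abs_le.1 (hsum σ D t)).2⟩ t
  have hHm : Measurable H := Measurable.iSup fun t => Finset.measurable_sum _ fun i _ =>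
    ((hm t).comp ((measurable_pi_apply i).comp measurable_snd)).sub
      ((hm t).comp ((measurable_pi_apply i).comp measurable_fst))
  have hHi : Integrable H (ν.prod ν) := Integrable.of_bound hHm.aestronglyMeasurable n
    (ae_of_all _ fun p => abs_ciSup_le (hsub p))
  have hAi : ∀ σ, Integrable (A σ) ν := fun σ =>
    Integrable.of_bound (measurable_signedSup hm σ).aestronglyMeasurable n
      (ae_of_all _ fun D => abs_ciSup_le (hsum σ D))
  have hli : ∀ t i, Integrable (fun D' : Fin n → Z => ℓ t (D' i)) ν := fun t i =>
    (measurePreserving_eval μ i).integrable_comp_of_integrable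
      (integrable_of_mem_unitInterval h0 h1 hm (μ i) t)
  -- The expected losses are averages over an independent copy of the sample.
  have ghost : ∫ D, maxDeviation μ ℓ D ∂ν ≤ ∫ p, H p ∂(ν.prod ν) := by
    rw [integral_prod _ hHi]
    refine integral_mono_ae (Integrable.of_bound
      (measurable_maxDeviation hm μ).aestronglyMeasurable n
      (ae_of_all _ fun D => abs_maxDeviation_le h0 h1 hm μ D)) hHi.integral_prod_left ?_
    filter_upwards [hHi.prod_right_ae] with D hD
    refine ciSup_le fun t => ?_
    have : ∑ i, (∫ z, ℓ t z ∂(μ i) - ℓ t (D i))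
        = ∫ D', ∑ i, (ℓ t (D' i) - ℓ t (D i)) ∂ν := by
      have hli' : ∀ i, Integrable (fun D' : Fin n → Z => ℓ t (D' i) - ℓ t (D i)) ν := fun i =>
        (hli t i).sub (integrable_const _)
      rw [integral_finsetSum _ fun i _ => hli' i]
      refine sum_congr rfl fun i _ => ?_
      rw [integral_sub (hli t i) (integrable_const _), integral_comp_eval
        (hm t).aestronglyMeasurable]
      simp
    rw [this]
    exact integral_mono (integrable_finsetSum _ fun i _ => (hli t i).sub (integrable_const _))
      hD fun D' => hHle (D, D') t
  -- Exchanging entries of the two copies preserves their law and introduces the signs `σ`.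
  have swap : ∀ σ : Fin n → ℤˣ, ∫ p, H p ∂(ν.prod ν) ≤ ∫ D, A σ D ∂ν + ∫ D, A (-σ) D ∂ν := by
    intro σ
    have hx := measurePreserving_exchange μ σ
    have e1 : ∫ p, H p ∂(ν.prod ν) = ∫ p, H (exchange σ p) ∂(ν.prod ν) := by
      conv_lhs => rw [hν, ← hx.map_eq]
      exact integral_map hx.measurable.aemeasurable hHm.aestronglyMeasurable
    have i2 := (hAi σ).comp_snd ν
    have i1 := (hAi (-σ)).comp_fst ν
    have e2 : ∫ p, H (exchange σ p) ∂(ν.prod ν)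
        ≤ ∫ p : (Fin n → Z) × (Fin n → Z), (A σ p.2 + A (-σ) p.1) ∂(ν.prod ν) := by
      refine integral_mono (hx.integrable_comp_of_integrable hHi) (i2.add i1) fun p => ?_
      refine ciSup_le fun t => ?_
      refine le_trans (le_of_eq ?_) (add_le_add (hAle σ p.2 t) (hAle (-σ) p.1 t))
      rw [← sum_add_distrib]
      refine sum_congr rfl fun i _ => ?_
      rcases Int.units_eq_one_or (σ i) with h | h
      · simp [exchange, h, sub_eq_add_neg]
      · simp [exchange, h, show ¬ ((-1 : ℤˣ) = 1) by decide]; ring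
    rw [e1]
    refine e2.trans (le_of_eq ?_)
    rw [integral_add i2 i1, integral_fun_snd, integral_fun_fst]
    simp
  have hR : ∫ D, rademacherSum ℓ D ∂ν = 𝔼 σ, ∫ D, A σ D ∂ν := by
    unfold rademacherSum
    simp_rw [Fintype.expect_eq_sum_div_card]
    rw [integral_div, integral_finsetSum _ fun σ _ => hAi σ]
  -- The signs `-σ` and `σ` have the same distribution.
  have hneg : 𝔼 σ : Fin n → ℤˣ, ∫ D, A (-σ) D ∂ν = 𝔼 σ, ∫ D, A σ D ∂ν :=
    Fintype.expect_equiv (Equiv.neg _) _ _ fun _ => rfl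
  have fin : 𝔼 σ : Fin n → ℤˣ, ∫ p, H p ∂(ν.prod ν)
      ≤ 𝔼 σ : Fin n → ℤˣ, (∫ D, A σ D ∂ν + ∫ D, A (-σ) D ∂ν) :=
    expect_le_expect fun σ _ => swap σ
  rw [Fintype.expect_const, expect_add_distrib, hneg] at fin
  rw [hR]
  linarith

/-- The uniform deviation bound. The bounded differences inequality is applied once, to
`maxDeviation - 2 * rademacherSum`, which has nonpositive mean and bounded differences `3`. -/
theorem measure_maxDeviation_ge_le [MeasurableSpace Z] [Countable T] [Nonempty T] {ℓ : T → Z → ℝ}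
    (h0 : ∀ t z, 0 ≤ ℓ t z) (h1 : ∀ t z, ℓ t z ≤ 1)
    (hm : ∀ t, Measurable (ℓ t)) (μ : Fin n → Measure Z) [∀ i, IsProbabilityMeasure (μ i)]
    {s : ℝ} (hs : 0 ≤ s) :
    (Measure.pi μ).real {D | 2 * rademacherSum ℓ D + 3 * s ≤ maxDeviation μ ℓ D}
      ≤ Real.exp (-2 * s ^ 2 / n) := by
  set ν := Measure.pi μ
  let g : (Fin n → Z) → ℝ := fun D => maxDeviation μ ℓ D - 2 * rademacherSum ℓ D
  have hsub := hasSubgaussianMGF_pi_of_bounded_differences μ g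
    ((measurable_maxDeviation hm μ).sub ((measurable_rademacherSum hm).const_mul 2)) (n + 2 * n)
    (fun D => by
      refine (abs_sub _ _).trans (add_le_add (abs_maxDeviation_le h0 h1 hm μ D) ?_)
      rw [abs_mul, abs_two]
      exact mul_le_mul_of_nonneg_left (abs_rademacherSum_le h0 h1 D) zero_le_two) 3
    (fun D i z => by
      have a := abs_le.1 (abs_maxDeviation_sub_update_le h0 h1 hm μ D i z)
      have b := abs_le.1 (abs_rademacherSum_sub_update_le h0 h1 D i z)
      rw [abs_le]
      push_cast
      constructor <;> simp only [g] <;> linarith [a.1, a.2, b.1, b.2])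
  have hmean : ∫ D, g D ∂ν ≤ 0 := by
    rw [integral_sub, integral_const_mul]
    · linarith [integral_maxDeviation_le h0 h1 hm μ]
    · exact Integrable.of_bound (measurable_maxDeviation hm μ).aestronglyMeasurable n
        (ae_of_all _ fun D => abs_maxDeviation_le h0 h1 hm μ D)
    · exact (Integrable.of_bound (measurable_rademacherSum hm).aestronglyMeasurable n
        (ae_of_all _ fun D => abs_rademacherSum_le h0 h1 D)).const_mul 2
  refine (measureReal_mono ?_).trans ((hsub.measure_ge_le (ε := 3 * s) (by positivity)).trans
    (le_of_eq ?_))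
  · intro D hD
    simp only [Set.mem_ofPred_eq, g] at hD ⊢
    simp only [g] at hmean
    linarith
  · congr 1
    push_cast
    by_cases hn : (n : ℝ) = 0
    · simp [hn]
    · field_simp

end Symmetrization

/-! ### The ramp loss -/

section RampLoss

variable {κ : Type*} [DecidableEq κ]

/-- The ramp loss `sup_{k ≠ y} clip (1 - (u y - u k))` of the margins of the scores `u` at the
label `y`, where `clip` truncates to `[0, 1]`. The entry `0` for `k = y` makes it `0` when there is
only one class. -/
noncomputable def rampLoss (u : κ → ℝ) (y : κ) : ℝ :=
  ⨆ k, if k = y then 0 else max 0 (min 1 (1 - (u y - u k)))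

theorem rampTerm_nonneg (u : κ → ℝ) (y k : κ) :
    0 ≤ if k = y then 0 else max 0 (min 1 (1 - (u y - u k))) := by
  split_ifs <;> simp

theorem rampTerm_le_one (u : κ → ℝ) (y k : κ) :
    (if k = y then 0 else max 0 (min 1 (1 - (u y - u k)))) ≤ 1 := by
  split_ifs <;> simp

theorem rampLoss_nonneg (u : κ → ℝ) (y : κ) : 0 ≤ rampLoss u y :=
  Real.iSup_nonneg fun k => rampTerm_nonneg u y k

theorem rampLoss_le_one (u : κ → ℝ) (y : κ) : rampLoss u y ≤ 1 :=
  Real.iSup_le (fun k => rampTerm_le_one u y k) zero_le_one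

theorem one_le_rampLoss [Finite κ] {u : κ → ℝ} {y k : κ} (hk : k ≠ y) (h : u y ≤ u k) :
    1 ≤ rampLoss u y := by
  refine le_trans ?_ (le_ciSup (Set.finite_range _).bddAbove k)
  rw [if_neg hk, min_eq_left (by linarith)]
  exact le_max_right _ _

theorem abs_rampLoss_sub_le {u v : κ → ℝ} {c : ℝ} (y : κ) (h : ∀ k, |u k - v k| ≤ c) :
    |rampLoss u y - rampLoss v y| ≤ 2 * c := by
  have : Nonempty κ := ⟨y⟩
  have hb : ∀ (w : κ → ℝ) k, |if k = y then 0 else max 0 (min 1 (1 - (w y - w k)))| ≤ 1 :=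
    fun w k => by rw [abs_of_nonneg (rampTerm_nonneg w y k)]; exact rampTerm_le_one w y k
  refine abs_ciSup_sub_ciSup_le (hb u) (hb v) fun k => ?_
  have hy := abs_le.1 (h y)
  have hk := abs_le.1 (h k)
  have h0 := (abs_nonneg _).trans (h k)
  split_ifs
  · simpa using h0
  · rw [max_comm 0, max_comm 0, min_comm 1, min_comm 1]
    refine (abs_max_sub_max_le_abs _ _ _).trans ((abs_min_sub_min_le_max _ _ _ _).trans ?_)
    rw [sub_self, abs_zero]
    refine max_le (abs_le.2 ?_) (by linarith)
    constructor <;> linarith [hy.1, hy.2, hk.1, hk.2]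

theorem exists_abs_rampLoss_sub_le [Finite κ] (u v : κ → ℝ) (y : κ) :
    ∃ k, |rampLoss u y - rampLoss v y| ≤ 2 * |u k - v k| := by
  have : Nonempty κ := ⟨y⟩
  obtain ⟨k, hk⟩ := Finite.exists_max fun k => |u k - v k|
  exact ⟨k, abs_rampLoss_sub_le y hk⟩

theorem continuous_rampLoss [Fintype κ] (y : κ) : Continuous fun u : κ → ℝ => rampLoss u y := by
  refine (LipschitzWith.of_dist_le_mul (K := 2) fun u v => ?_).continuous
  rw [Real.dist_eq, dist_eq_norm]
  exact abs_rampLoss_sub_le y fun k => norm_le_pi_norm (u - v) k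

theorem ramp_le_log_div (v : ℝ) :
    max 0 (min 1 (1 - v)) ≤ Real.log (1 + Real.exp (-v)) / Real.log 2 := by
  have hl : 0 < Real.log 2 := Real.log_pos one_lt_two
  have he := Real.exp_pos (-v)
  rw [le_div_iff₀ hl]
  refine (max_mul_of_nonneg 0 (min 1 (1 - v)) hl.le).trans_le (max_le ?_ ?_)
  · rw [zero_mul]
    exact Real.log_nonneg (by linarith)
  rcases le_or_gt v 0 with hv | hv
  · refine (mul_le_mul_of_nonneg_right (min_le_left _ _) hl.le).trans ?_
    rw [one_mul]
    refine Real.log_le_log two_pos ?_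
    linarith [Real.one_le_exp (by linarith : 0 ≤ -v)]
  · refine (mul_le_mul_of_nonneg_right (min_le_right _ _) hl.le).trans ?_
    rcases le_or_gt v 1 with hv1 | hv1
    · -- `1 + exp (-v) ≥ 2 - v`, and `log` is concave on `[1, 2]`.
      have hc := strictConcaveOn_log_Ioi.concaveOn.2 (Set.mem_Ioi.2 two_pos)
        (Set.mem_Ioi.2 one_pos) (by linarith : 0 ≤ 1 - v) hv.le (by ring)
      simp only [smul_eq_mul, Real.log_one, mul_zero, add_zero] at hc
      refine hc.trans (Real.log_le_log (by linarith) ?_)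
      linarith [Real.add_one_le_exp (-v)]
    · exact (mul_nonpos_of_nonpos_of_nonneg (by linarith) hl.le).trans
        (Real.log_nonneg (by linarith))

end RampLoss

namespace MarginBound

variable {X : Type*} {K d N : ℕ}

/-- The `γ`-margin ramp loss at `z = (x, y)` of the linear heads `w`. -/
noncomputable def headLoss (φ : X → EuclideanSpace ℝ (Fin d)) (γ : Fin K → ℝ)
    (w : Fin K → EuclideanSpace ℝ (Fin d)) (z : X × Fin K) : ℝ :=
  rampLoss (fun k => inner ℝ (w k) ((γ z.2)⁻¹ • φ z.1)) z.2

theorem neg_log_softmax (u : Fin K → ℝ) (y : Fin K) :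
    -Real.log (softmax u y) = Real.log (∑ k, Real.exp (-(u y - u k))) := by
  unfold softmax
  rw [← Real.log_inv, inv_div, Finset.sum_div]
  congr 1
  refine Finset.sum_congr rfl fun k _ => ?_
  rw [← Real.exp_sub]
  congr 1
  ring

/-- The cross-entropy loss, in bits, dominates the ramp loss. -/
theorem rampLoss_le_neg_log_softmax_div (u : Fin K → ℝ) (y : Fin K) :
    rampLoss u y ≤ -Real.log (softmax u y) / Real.log 2 := by
  have hl : 0 < Real.log 2 := Real.log_pos one_lt_two
  rw [neg_log_softmax]
  have h1 : 1 ≤ ∑ k, Real.exp (-(u y - u k)) := by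
    refine le_trans ?_ (Finset.single_le_sum (f := fun k => Real.exp (-(u y - u k)))
      (fun k _ => (Real.exp_pos _).le) (Finset.mem_univ y))
    simp
  refine Real.iSup_le (fun k => ?_) (div_nonneg (Real.log_nonneg h1) hl.le)
  split_ifs with hk
  · exact div_nonneg (Real.log_nonneg h1) hl.le
  · refine (ramp_le_log_div (u y - u k)).trans ?_
    refine div_le_div_of_nonneg_right (Real.log_le_log (by positivity) ?_) hl.le
    have := Finset.sum_le_sum_of_subset_of_nonneg (f := fun k => Real.exp (-(u y - u k)))
      (Finset.subset_univ ({y, k} : Finset (Fin K))) (fun k _ _ => (Real.exp_pos _).le)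
    rw [Finset.sum_pair (Ne.symm hk)] at this
    simpa using this

section HeadLoss

variable (φ : X → EuclideanSpace ℝ (Fin d)) (γ : Fin K → ℝ)

theorem measurable_headLoss [MeasurableSpace X] (hφ : Measurable φ)
    (w : Fin K → EuclideanSpace ℝ (Fin d)) : Measurable (headLoss φ γ w) := by
  have hv : Measurable fun z : X × Fin K => (γ z.2)⁻¹ • φ z.1 :=
    ((measurable_of_countable γ).comp measurable_snd).inv.smul (hφ.comp measurable_fst)
  have hw : Measurable fun z : X × Fin K => w z.2 :=
    (measurable_of_countable w).comp measurable_snd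
  refine Measurable.iSup fun k => Measurable.ite ?_ measurable_const ?_
  · exact measurable_snd (measurableSet_eq (a := k)) |>.congr (by ext; simp [eq_comm])
  · exact measurable_const.max (measurable_const.min
      (measurable_const.sub ((hw.inner hv).sub (measurable_const.inner hv))))

theorem abs_headLoss_le_one (w : Fin K → EuclideanSpace ℝ (Fin d)) (z : X × Fin K) :
    |headLoss φ γ w z| ≤ 1 := by
  unfold headLoss
  rw [abs_of_nonneg (rampLoss_nonneg _ _)]
  exact rampLoss_le_one _ _

theorem headLoss_le_ceLoss {w : Fin K → EuclideanSpace ℝ (Fin d)} {f : X → Fin K → ℝ}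
    (hf : ∀ x y, f x y = inner ℝ (w y) (φ x)) (z : X × Fin K) :
    headLoss φ γ w z ≤ ceLoss γ f z.1 z.2 / Real.log 2 := by
  refine le_of_eq_of_le ?_ (rampLoss_le_neg_log_softmax_div _ z.2)
  unfold headLoss
  congr 1
  funext k
  rw [hf, inner_smul_right]
  ring

theorem risk_le_integral_headLoss [MeasurableSpace X] (hφ : Measurable φ) (hγ : ∀ k, 0 < γ k)
    (P : Measure (X × Fin K)) [IsProbabilityMeasure P]
    {amax : (Fin K → ℝ) → Fin K} (hamax : IsArgmax amax)
    {w : Fin K → EuclideanSpace ℝ (Fin d)} {f : X → Fin K → ℝ}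
    (hf : ∀ x y, f x y = inner ℝ (w y) (φ x)) :
    risk P amax f ≤ ∫ z, headLoss φ γ w z ∂P := by
  have hi : Integrable (headLoss φ γ w) P := Integrable.of_bound
    (measurable_headLoss φ γ hφ w).aestronglyMeasurable 1
      (ae_of_all _ fun z => abs_headLoss_le_one φ γ w z)
  have hmk := mul_meas_ge_le_integral_of_nonneg (ae_of_all P fun z => rampLoss_nonneg _ _) hi 1
  rw [one_mul] at hmk
  -- `amax` need not be measurable: the error event is enclosed in a superlevel set of the loss.
  refine le_trans (measureReal_mono fun z hz => ?_) hmk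
  refine one_le_rampLoss (k := amax (f z.1)) (Ne.symm hz) ?_
  have := hamax (f z.1) z.2
  rw [hf, hf] at this
  simp only [inner_smul_right]
  exact mul_le_mul_of_nonneg_left this (inv_nonneg.2 (hγ _).le)

theorem continuous_headLoss (z : X × Fin K) :
    Continuous fun w : Fin K → EuclideanSpace ℝ (Fin d) => headLoss φ γ w z :=
  (continuous_rampLoss z.2).comp (by fun_prop)

theorem continuous_integral_headLoss [MeasurableSpace X] (hφ : Measurable φ)
    (μ : Measure (X × Fin K)) [IsFiniteMeasure μ] :
    Continuous fun w : Fin K → EuclideanSpace ℝ (Fin d) => ∫ z, headLoss φ γ w z ∂μ :=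
  continuous_of_dominated (bound := fun _ => 1)
    (fun w => (measurable_headLoss φ γ hφ w).aestronglyMeasurable)
    (fun w => ae_of_all _ fun z => abs_headLoss_le_one φ γ w z)
    (integrable_const _) (ae_of_all _ fun z => continuous_headLoss φ γ z)

open Finset in
/-- The Rademacher average of the ramp loss over linear heads in the ball of radius `Λ`. The
contraction principle passes to the scores, where the supremum over the heads is computed by the
Cauchy–Schwarz inequality. -/
theorem rademacherSum_headLoss_le {T : Type*} [Nonempty T] {Λ : ℝ}
    (w : T → Fin K → EuclideanSpace ℝ (Fin d)) (hw : ∀ t k, ‖w t k‖ ≤ Λ)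
    (D : Fin N → X × Fin K) :
    rademacherSum (fun t => headLoss φ γ (w t)) D
      ≤ 2 * (Λ * (K * √(∑ i, ‖(γ (D i).2)⁻¹ • φ (D i).1‖ ^ 2))) := by
  set v : Fin N → EuclideanSpace ℝ (Fin d) := fun i => (γ (D i).2)⁻¹ • φ (D i).1 with hv
  have hc := expect_ciSup_add_sum_le (fun _ : T => 0) (fun i t => headLoss φ γ (w t) (D i))
    (fun i k t => inner ℝ (w t k) (v i)) ⟨0, by simp⟩
    (fun i => ⟨1, fun t => abs_headLoss_le_one φ γ (w t) (D i)⟩)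
    (fun i k => ⟨Λ * ‖v i‖, fun t => (abs_real_inner_le_norm _ _).trans
      (mul_le_mul_of_nonneg_right (hw t k) (norm_nonneg _))⟩)
    (fun i s t => exists_abs_rampLoss_sub_le _ _ _)
  simp only [zero_add] at hc
  refine hc.trans ?_
  have hΛ : 0 ≤ Λ ∨ K = 0 := by
    rcases Nat.eq_zero_or_pos K with h | h
    · exact Or.inr h
    · exact Or.inl ((norm_nonneg _).trans (hw (Classical.arbitrary T) ⟨0, h⟩))
  calc _ ≤ 𝔼 τ : Fin N → Fin K → ℤˣ, 2 * (Λ * ∑ k, ‖∑ i, ((τ i k : ℤ) : ℝ) • v i‖) := by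
        refine expect_le_expect fun τ _ => ciSup_le fun t => ?_
        refine mul_le_mul_of_nonneg_left ?_ zero_le_two
        rw [sum_comm, mul_sum]
        refine sum_le_sum fun k _ => ?_
        have : ∑ i, ((τ i k : ℤ) : ℝ) * inner ℝ (w t k) (v i)
            = inner ℝ (w t k) (∑ i, ((τ i k : ℤ) : ℝ) • v i) := by
          simp_rw [inner_sum, inner_smul_right]
        rw [this]
        exact (real_inner_le_norm _ _).trans
          (mul_le_mul_of_nonneg_right (hw t k) (norm_nonneg _))
    _ = 2 * (Λ * ∑ k : Fin K, 𝔼 τ : Fin N → Fin K → ℤˣ, ‖∑ i, ((τ i k : ℤ) : ℝ) • v i‖) := by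
        rw [← mul_expect, ← mul_expect, expect_sum_comm]
    _ ≤ _ := by
        refine mul_le_mul_of_nonneg_left ?_ zero_le_two
        rcases hΛ with hΛ | rfl
        · refine mul_le_mul_of_nonneg_left ?_ hΛ
          refine (sum_le_sum fun k _ => expect_norm_sum_le k v).trans ?_
          simp [hv]
        · simp

end HeadLoss

/-! ### Class-wise second moments -/

/-- The decomposition of the second moment of a class into squared mean and mean squared deviation.
It also holds for an empty class, where both sides vanish. -/
theorem sum_classIdx_norm_sq (φ : X → EuclideanSpace ℝ (Fin d)) (D : Fin N → X × Fin K)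
    (k : Fin K) :
    ∑ i ∈ classIdx D k, ‖φ (D i).1‖ ^ 2
      = (classIdx D k).card * (‖classMean φ D k‖ ^ 2 + classMSD φ D k) := by
  rcases (classIdx D k).eq_empty_or_nonempty with h | h
  · simp [h]
  have hc : ((classIdx D k).card : ℝ) ≠ 0 := by
    exact_mod_cast h.card_pos.ne'
  have hm : ∑ i ∈ classIdx D k, φ (D i).1
      = ((classIdx D k).card : ℝ) • classMean φ D k := by
    rw [classMean, smul_smul, mul_one_div_cancel hc, one_smul]
  rw [mul_add, classMSD, ← mul_assoc, mul_one_div_cancel hc, one_mul]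
  simp_rw [norm_sub_sq_real, Finset.sum_add_distrib, Finset.sum_sub_distrib, ← Finset.mul_sum,
    ← sum_inner, hm, inner_smul_left, real_inner_self_eq_norm_sq]
  simp
  ring

theorem sum_norm_smul_sq_le (φ : X → EuclideanSpace ℝ (Fin d)) (γ : Fin K → ℝ)
    (D : Fin N → X × Fin K) :
    ∑ i, ‖(γ (D i).2)⁻¹ • φ (D i).1‖ ^ 2
      ≤ N * ∑ k, (‖classMean φ D k‖ ^ 2 + classMSD φ D k) / γ k ^ 2 := by
  rw [← Finset.sum_fiberwise (s := Finset.univ) (g := fun i => (D i).2), Finset.mul_sum]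
  refine Finset.sum_le_sum fun k _ => ?_
  have : ∑ i with (D i).2 = k, ‖(γ (D i).2)⁻¹ • φ (D i).1‖ ^ 2
      = (∑ i ∈ classIdx D k, ‖φ (D i).1‖ ^ 2) / γ k ^ 2 := by
    rw [Finset.sum_div]
    refine Finset.sum_congr rfl fun i hi => ?_
    rw [(Finset.mem_filter.1 hi).2, norm_smul, mul_pow, norm_inv, Real.norm_eq_abs, inv_pow,
      sq_abs]
    ring
  rw [this, sum_classIdx_norm_sq, mul_div_assoc]
  refine mul_le_mul_of_nonneg_right ?_ ?_
  · exact_mod_cast (Finset.card_le_univ _).trans (Fintype.card_fin N).le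
  · refine div_nonneg (add_nonneg (sq_nonneg _) ?_) (sq_nonneg _)
    exact mul_nonneg (by positivity) (Finset.sum_nonneg fun _ _ => sq_nonneg _)

/-! ### The margin bound for independent samples -/

section Independent

variable [MeasurableSpace X]

/-- The margin bound for independent, not necessarily identically distributed examples whose laws
average to `P`. -/
theorem pi_measure_not_forall_le (hN : 0 < N) (P : Measure (X × Fin K)) [IsProbabilityMeasure P]
    (μ : Fin N → Measure (X × Fin K)) [∀ i, IsProbabilityMeasure (μ i)]
    (hμ : ∑ i, μ i = (N : ℝ≥0∞) • P)
    (φ : X → EuclideanSpace ℝ (Fin d)) (hφ : Measurable φ)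
    (amax : (Fin K → ℝ) → Fin K) (hamax : IsArgmax amax)
    (γ : Fin K → ℝ) (hγ : ∀ k, 0 < γ k) (Λ δ : ℝ) (hδ : 0 < δ) :
    Measure.pi μ {D | ¬ ∀ f ∈ linearHeads φ K Λ, risk P amax f ≤ marginBound φ γ Λ δ D f}
      ≤ ENNReal.ofReal δ := by
  rcases le_or_gt 1 δ with hδ1 | hδ1
  · exact prob_le_one.trans (by simpa using hδ1)
  have hN' : (0 : ℝ) < N := by exact_mod_cast hN
  obtain ⟨z₀⟩ : Nonempty (X × Fin K) := P.nonempty_of_neZero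
  rcases lt_or_ge Λ 0 with hΛ | hΛ
  · have : linearHeads φ K Λ = ∅ := by
      ext f
      simp only [Set.mem_empty_iff_false, iff_false]
      rintro ⟨w, hw, -⟩
      linarith [norm_nonneg (w z₀.2), hw z₀.2]
    simp [this]
  let B := {w : Fin K → EuclideanSpace ℝ (Fin d) // ∀ k, ‖w k‖ ≤ Λ}
  have : Nonempty B := ⟨⟨fun _ => 0, fun _ => by simpa using hΛ⟩⟩
  -- A dense sequence of heads keeps the suprema measurable.
  let w : ℕ → Fin K → EuclideanSpace ℝ (Fin d) := fun t => (TopologicalSpace.denseSeq B t).1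
  have hw : ∀ t k, ‖w t k‖ ≤ Λ := fun t => (TopologicalSpace.denseSeq B t).2
  let ℓ : ℕ → X × Fin K → ℝ := fun t => headLoss φ γ (w t)
  have h0 : ∀ t z, 0 ≤ ℓ t z := fun t z => rampLoss_nonneg _ _
  have h1 : ∀ t z, ℓ t z ≤ 1 := fun t z => rampLoss_le_one _ _
  have hm : ∀ t, Measurable (ℓ t) := fun t => measurable_headLoss φ γ hφ _
  have hL : 0 ≤ Real.log (2 / δ) := Real.log_nonneg (by rw [le_div_iff₀ hδ]; linarith)
  set s : ℝ := √(N * Real.log (2 / δ) / 2) with hs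
  have hdev : ∀ (D : Fin N → X × Fin K) (b : B),
      ∑ i, (∫ z, headLoss φ γ b.1 z ∂(μ i) - headLoss φ γ b.1 (D i)) ≤ maxDeviation μ ℓ D := by
    intro D b
    refine (TopologicalSpace.denseRange_denseSeq B).induction_on
      (p := fun b : B => ∑ i, (∫ z, headLoss φ γ b.1 z ∂(μ i) - headLoss φ γ b.1 (D i))
        ≤ maxDeviation μ ℓ D) b ?_ fun t => sum_integral_sub_le_maxDeviation h0 h1 hm μ D t
    refine isClosed_le (continuous_finsetSum _ fun i _ => ?_) continuous_const
    exact ((continuous_integral_headLoss φ γ hφ (μ i)).comp continuous_subtype_val).sub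
      ((continuous_headLoss φ γ (D i)).comp continuous_subtype_val)
  have hsub : {D | ¬ ∀ f ∈ linearHeads φ K Λ, risk P amax f ≤ marginBound φ γ Λ δ D f}
      ⊆ {D | 2 * rademacherSum ℓ D + 3 * s ≤ maxDeviation μ ℓ D} := by
    intro D hD
    by_contra hlt
    refine hD ?_
    rintro f ⟨b, hb, hf⟩
    simp only [Set.mem_ofPred_eq, not_le] at hlt
    have hrisk := risk_le_integral_headLoss φ γ hφ hγ P hamax hf
    have hint : ∑ i, ∫ z, headLoss φ γ b z ∂(μ i) = N * ∫ z, headLoss φ γ b z ∂P := by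
      rw [← integral_finsetSum_measure, hμ, integral_smul_measure]
      · simp
      · intro i _
        exact Integrable.of_bound (measurable_headLoss φ γ hφ b).aestronglyMeasurable 1
          (ae_of_all _ fun z => abs_headLoss_le_one φ γ b z)
    have hd := hdev D ⟨b, hb⟩
    simp only [Finset.sum_sub_distrib] at hd
    rw [hint] at hd
    have hce : ∑ i, headLoss φ γ b (D i) ≤ N * ((1 / Real.log 2) * ceRisk γ D f) := by
      refine (Finset.sum_le_sum fun i _ => headLoss_le_ceLoss φ γ hf (D i)).trans (le_of_eq ?_)
      rw [← Finset.sum_div, ceRisk]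
      field_simp
    set S := ∑ k, (‖classMean φ D k‖ ^ 2 + classMSD φ D k) / γ k ^ 2 with hS
    have hrad : rademacherSum ℓ D ≤ 2 * (Λ * (K * (√N * √S))) := by
      refine (rademacherSum_headLoss_le φ γ w hw D).trans ?_
      rw [← Real.sqrt_mul hN'.le]
      gcongr
      exact sum_norm_smul_sq_le φ γ D
    have hsN : s = N * √(Real.log (2 / δ) / (2 * N)) := by
      rw [hs, ← Real.sqrt_sq hN'.le, ← Real.sqrt_mul (sq_nonneg _), Real.sqrt_sq hN'.le]
      congr 1
      field_simp
    -- The constant `4` obtained here is weakened to `4√2`.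
    have hmid : 2 * (2 * (Λ * (K * (√N * √S)))) ≤ N * (4 * √2 * Λ * K / √N * √S) := by
      have e : (N : ℝ) * (4 * √2 * Λ * K / √N * √S) = √2 * (2 * (2 * (Λ * (K * (√N * √S))))) := by
        have h2 : (N : ℝ) / √N = √N := Real.div_sqrt
        calc (N : ℝ) * (4 * √2 * Λ * K / √N * √S) = 4 * √2 * Λ * K * √S * (N / √N) := by ring
          _ = _ := by rw [h2]; ring
      rw [e]
      exact le_mul_of_one_le_left (by positivity) (Real.one_le_sqrt.2 one_le_two)
    refine le_of_mul_le_mul_left ?_ hN'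
    have : (N : ℝ) * marginBound φ γ Λ δ D f = N * ((1 / Real.log 2) * ceRisk γ D f)
        + N * (4 * √2 * Λ * K / √N * √S) + 3 * s := by
      rw [hsN, marginBound]
      ring
    rw [this]
    have := mul_le_mul_of_nonneg_left hrisk hN'.le
    linarith
  refine (measure_mono hsub).trans ?_
  rw [← ofReal_measureReal]
  refine ENNReal.ofReal_le_ofReal ?_
  refine (measure_maxDeviation_ge_le h0 h1 hm μ (Real.sqrt_nonneg _)).trans ?_
  have : -2 * s ^ 2 / N = -Real.log (2 / δ) := by
    rw [hs, Real.sq_sqrt (by positivity)]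
    field_simp
  rw [this, Real.exp_neg, Real.exp_log (by positivity), inv_div]
  linarith

/-! ### Conditioning on the labels -/

theorem measurableSet_label (k : Fin K) : MeasurableSet {p : X × Fin K | p.2 = k} :=
  measurable_snd (measurableSet_singleton k)

/-- A power of `P` conditioned on a box is the product of the conditioned factors. -/
theorem pi_inter_univ_pi {ι Z : Type*} [Fintype ι] [MeasurableSpace Z] (P : Measure Z)
    [IsProbabilityMeasure P] {s : ι → Set Z} (hs : ∀ i, MeasurableSet (s i))
    (hP : ∀ i, P (s i) ≠ 0) (A : Set (ι → Z)) :
    Measure.pi (fun _ => P) (Set.univ.pi s ∩ A)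
      = Measure.pi (fun _ => P) (Set.univ.pi s) * Measure.pi (fun i => P[|s i]) A := by
  have (i : ι) : IsProbabilityMeasure P[|s i] := cond_isProbabilityMeasure (hP i)
  have h : Measure.pi (fun i => P[|s i])
      = (∏ i, (P (s i))⁻¹) • (Measure.pi fun _ => P).restrict (Set.univ.pi s) := by
    rw [Measure.restrict_pi_pi]
    refine Measure.pi_eq fun t _ => ?_
    rw [Measure.smul_apply, Measure.pi_pi, smul_eq_mul, ← Finset.prod_mul_distrib]
    rfl
  rw [h, Measure.smul_apply, Measure.restrict_apply' (MeasurableSet.univ_pi hs), smul_eq_mul,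
    Measure.pi_pi, ← mul_assoc, ← Finset.prod_mul_distrib, Set.inter_comm]
  simp_rw [ENNReal.mul_inv_cancel (hP _) (measure_ne_top P _)]
  simp

/-- If every class has prior `1 / K` and the label vector `y` is balanced, then the class
conditionals of `P` along `y` average to `P`. -/
theorem sum_cond_label (P : Measure (X × Fin K)) [IsProbabilityMeasure P]
    (hP : ∀ k : Fin K, P {p | p.2 = k} = (K : ℝ≥0∞)⁻¹) (y : Fin N → Fin K)
    (hy : ∀ k, ((Finset.univ.filter fun i => y i = k).card : ℝ) = (N : ℝ) / K) :
    ∑ i, P[|{p : X × Fin K | p.2 = y i}] = (N : ℝ≥0∞) • P := by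
  ext A hA
  simp only [Measure.finsetSum_apply, Measure.smul_apply, smul_eq_mul]
  simp_rw [cond_apply (measurableSet_label _), hP, inv_inv]
  rw [← Finset.sum_fiberwise (s := Finset.univ) (g := y)]
  have h1 : ∀ k, ∑ i with y i = k, (K : ℝ≥0∞) * P ({p | p.2 = y i} ∩ A)
      = N * P ({p | p.2 = k} ∩ A) := by
    intro k
    have hK : (K : ℝ) ≠ 0 := by exact_mod_cast (Fin.pos k).ne'
    have hcard : (Finset.univ.filter fun i => y i = k).card * K = N := by
      have := hy k
      rw [eq_div_iff hK] at this
      exact_mod_cast this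
    rw [Finset.sum_congr rfl fun i hi => by rw [(Finset.mem_filter.1 hi).2], Finset.sum_const,
      nsmul_eq_mul, ← mul_assoc]
    congr 1
    exact_mod_cast hcard
  simp_rw [h1, ← Finset.mul_sum]
  congr 1
  have := sum_measure_preimage_singleton (μ := P.restrict A) (f := Prod.snd)
    (Finset.univ : Finset (Fin K)) fun k _ => measurableSet_label (X := X) k
  simp only [Finset.coe_univ, Set.preimage_univ, Measure.restrict_apply_univ] at this
  rw [← this]
  refine Finset.sum_congr rfl fun k _ => ?_
  exact (Measure.restrict_apply (measurableSet_label k)).symm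

/-- Given a balanced label vector the features are independent, so the bound for independent
samples applies; the balanced samples are a finite disjoint union over such label vectors. -/
theorem cond_balanced_le (hN : 0 < N) (P : Measure (X × Fin K)) [IsProbabilityMeasure P]
    (hP : ∀ k : Fin K, P {p | p.2 = k} = (K : ℝ≥0∞)⁻¹)
    (φ : X → EuclideanSpace ℝ (Fin d)) (hφ : Measurable φ)
    (amax : (Fin K → ℝ) → Fin K) (hamax : IsArgmax amax)
    (γ : Fin K → ℝ) (hγ : ∀ k, 0 < γ k) (Λ δ : ℝ) (hδ : 0 < δ) :
    (Measure.pi fun _ : Fin N => P)[|{D | IsBalanced D}]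
        {D | ¬ ∀ f ∈ linearHeads φ K Λ, risk P amax f ≤ marginBound φ γ Λ δ D f}
      ≤ ENNReal.ofReal δ := by
  classical
  set bad := {D : Fin N → X × Fin K |
    ¬ ∀ f ∈ linearHeads φ K Λ, risk P amax f ≤ marginBound φ γ Λ δ D f}
  set ν := Measure.pi fun _ : Fin N => P
  let labels : (Fin N → X × Fin K) → Fin N → Fin K := fun D i => (D i).2
  let L : Finset (Fin N → Fin K) := Finset.univ.filter fun y =>
    ∀ k, ((Finset.univ.filter fun i => y i = k).card : ℝ) = (N : ℝ) / K
  have hfib : ∀ y, labels ⁻¹' {y} = Set.univ.pi fun i => {p : X × Fin K | p.2 = y i} := by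
    intro y
    ext D
    simp [labels, funext_iff]
  have hmeas : ∀ y, MeasurableSet (labels ⁻¹' {y}) := fun y => by
    rw [hfib]
    exact MeasurableSet.univ_pi fun i => measurableSet_label _
  have hbal : {D : Fin N → X × Fin K | IsBalanced D} = labels ⁻¹' (L : Set (Fin N → Fin K)) := by
    ext D
    simp [L, labels, IsBalanced, classIdx]
  have hsum := sum_measure_preimage_singleton (μ := ν) (f := labels) L fun y _ => hmeas y
  have hP0 : ∀ k : Fin K, P {p | p.2 = k} ≠ 0 := fun k => by
    rw [hP]
    exact ENNReal.inv_ne_zero.2 (ENNReal.natCast_ne_top K)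
  have hfiber : ∀ y ∈ L, ν (labels ⁻¹' {y} ∩ bad) ≤ ν (labels ⁻¹' {y}) * ENNReal.ofReal δ := by
    intro y hy
    have (i : Fin N) : IsProbabilityMeasure P[|{p : X × Fin K | p.2 = y i}] :=
      cond_isProbabilityMeasure (hP0 _)
    rw [hfib, pi_inter_univ_pi P (fun i => measurableSet_label (y i)) fun i => hP0 (y i)]
    gcongr
    exact pi_measure_not_forall_le hN P _ (sum_cond_label P hP y (Finset.mem_filter.1 hy).2)
      φ hφ amax hamax γ hγ Λ δ hδ
  have hmb : MeasurableSet {D : Fin N → X × Fin K | IsBalanced D} := by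
    rw [hbal, ← Set.biUnion_preimage_singleton]
    exact L.measurableSet_biUnion fun y _ => hmeas y
  have hmain : ν ({D | IsBalanced D} ∩ bad) ≤ ν {D | IsBalanced D} * ENNReal.ofReal δ := by
    rw [hbal, ← hsum, Finset.sum_mul]
    refine le_trans ?_ (Finset.sum_le_sum hfiber)
    refine le_trans (measure_mono ?_) (measure_biUnion_finset_le L _)
    rintro D ⟨hD, hb⟩
    exact Set.mem_biUnion hD ⟨rfl, hb⟩
  rw [cond_apply hmb]
  calc _ ≤ (ν {D | IsBalanced D})⁻¹ * (ν {D | IsBalanced D} * ENNReal.ofReal δ) := by gcongr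
    _ = ((ν {D | IsBalanced D})⁻¹ * ν {D | IsBalanced D}) * ENNReal.ofReal δ := by rw [mul_assoc]
    _ ≤ 1 * ENNReal.ofReal δ := by gcongr; exact ENNReal.inv_mul_le_one _
    _ = _ := one_mul _

end Independent

end MarginBound

theorem proposition1 {X : Type*} [MeasurableSpace X] (K d N : ℕ) (hN : 0 < N)
    (P : Measure (X × Fin K)) [IsProbabilityMeasure P]
    (hP : ∀ k : Fin K, P {p | p.2 = k} = (K : ℝ≥0∞)⁻¹)
    (φ : X → EuclideanSpace ℝ (Fin d)) (hφ : Measurable φ)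
    (amax : (Fin K → ℝ) → Fin K) (hamax : MarginBound.IsArgmax amax)
    (γ : Fin K → ℝ) (hγ : ∀ k, 0 < γ k) (Λ δ : ℝ) (hδ : 0 < δ) :
    (Measure.pi fun _ : Fin N => P)
        {D | ¬ ∀ f ∈ MarginBound.linearHeads φ K Λ,
          MarginBound.risk P amax f ≤ MarginBound.marginBound φ γ Λ δ D f}
      ≤ ENNReal.ofReal δ ∧
    (K ∣ N →
      (ProbabilityTheory.cond (Measure.pi fun _ : Fin N => P)
          {D | MarginBound.IsBalanced D})
        {D | ¬ ∀ f ∈ MarginBound.linearHeads φ K Λ,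
          MarginBound.risk P amax f ≤ MarginBound.marginBound φ γ Λ δ D f}
      ≤ ENNReal.ofReal δ) :=
  ⟨MarginBound.pi_measure_not_forall_le hN P (fun _ => P)
      (by simp [Finset.sum_const, ← Nat.cast_smul_eq_nsmul ℝ≥0∞]) φ hφ amax hamax γ hγ Λ δ hδ,
    fun _ => MarginBound.cond_balanced_le hN P hP φ hφ amax hamax γ hγ Λ δ hδ⟩
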